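/- For $Z_1,\dots,Z_k,x\in\mathbb R^d$ and $r\ge 0$, the \emph{centrality SDP} with parameters $Z_1,\dots,Z_k,x,r$ is the problem of maximizing $\frac1k\sum_{i=1}^k b_i$ over all symmetric block matrices \[ Y=\begin{pmatrix}1&b^\top&u^\top\\ b&B&W\\ u&W^\top&U\end{pmatrix}\in\mathbb R^{(1+k+d)\times(1+k+d)},\qquad b\in\mathbb R^k,\ u\in\mathbb R^d,\ B\in\mathbb R^{k\times k},\ W\in\mathbb R^{k\times d},\ U\in\mathbb R^{d\times d}, \] subject to $Y\succeq 0$, $B_{ii}\le 1$ for $i=1,\dots,k$, $\operatorname{Tr}U\le 1$, and $\langle Z_i-x,W_i\rangle\ge r\,b_i$ for $i=1,\dots,k$, where $W_i$ is the $i$-th row of $W$. For $r>0$ and $p\in[0,1]$, the point $x$ is called \emph{certifiably $(r,p)$-central} with respect to $Z_1,\dots,Z_k$ if the optimum value of this SDP is at most $p$. There are absolute constants $C,c>0$ such that the following holds for every $d$ and every $k\ge 1$. Let $Z$ be a random vector in $\mathbb R^d$ with finite second moment, mean $\mu$ and covariance matrix $\Sigma$, and let $Z_1,\dots,Z_k$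 be i.i.d. copies of $Z$. Then for every $r>0$ with \[ r\ \ge\ C\left(\sqrt{\operatorname{Tr}\Sigma/k}+\sqrt{\|\Sigma\|}\right), \] where $\|\Sigma\|$ is the operator norm of $\Sigma$, with probability at least $1-2^{-ck}$ the mean $\mu$ is certifiably $(r,1/100)$-central with respect to $Z_1,\dots,Z_k$. -/

import Mathlib

open MeasureTheory ProbabilityTheory

noncomputable section

/-- Index set of the rows and columns of the `(d + k + 1) × (d + k + 1)` matrices of the
centrality SDP: one leading index, then `k` indices, then `d` indices. -/
abbrev SDPIndex (k d : ℕ) : Type := Unit ⊕ (Fin k ⊕ Fin d)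

namespace CentralitySDP

variable {k d : ℕ}

/-- The block `b ∈ ℝᵏ` of `Y = (1 bᵀ uᵀ; b B W; u Wᵀ U)`. -/
def blockb (Y : Matrix (SDPIndex k d) (SDPIndex k d) ℝ) (i : Fin k) : ℝ :=
  Y (.inr (.inl i)) (.inl ())

/-- The block `B ∈ ℝ^{k × k}` of `Y`. -/
def blockB (Y : Matrix (SDPIndex k d) (SDPIndex k d) ℝ) : Matrix (Fin k) (Fin k) ℝ :=
  Matrix.of fun i j => Y (.inr (.inl i)) (.inr (.inl j))

/-- The `i`-th row `W_i ∈ ℝᵈ` of the block `W ∈ ℝ^{k × d}` of `Y`. -/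
def rowW (Y : Matrix (SDPIndex k d) (SDPIndex k d) ℝ) (i : Fin k) : EuclideanSpace ℝ (Fin d) :=
  WithLp.toLp 2 fun j => Y (.inr (.inl i)) (.inr (.inr j))

/-- The block `U ∈ ℝ^{d × d}` of `Y`. -/
def blockU (Y : Matrix (SDPIndex k d) (SDPIndex k d) ℝ) : Matrix (Fin d) (Fin d) ℝ :=
  Matrix.of fun i j => Y (.inr (.inr i)) (.inr (.inr j))

/-- `Y` is a feasible solution of the centrality SDP with parameters `Z_1, …, Z_k, x, r`.
The symmetric block structure (`bᵀ`, `uᵀ`, `Wᵀ` above the diagonal or below it) is part of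
`Y.PosSemidef`. -/
structure Feasible (Z : Fin k → EuclideanSpace ℝ (Fin d)) (x : EuclideanSpace ℝ (Fin d)) (r : ℝ)
    (Y : Matrix (SDPIndex k d) (SDPIndex k d) ℝ) : Prop where
  corner : Y (.inl ()) (.inl ()) = 1
  diag_le : ∀ i, blockB Y i i ≤ 1
  trace_le : (blockU Y).trace ≤ 1
  inner_ge : ∀ i, r * blockb Y i ≤ inner ℝ (Z i - x) (rowW Y i)
  posSemidef : Y.PosSemidef

/-- The objective function `(1/k) ∑ b_i`. -/
def objective (Y : Matrix (SDPIndex k d) (SDPIndex k d) ℝ) : ℝ :=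
  (1 / (k : ℝ)) * ∑ i, blockb Y i

/-- The optimum value of the centrality SDP. The set of objective values is nonempty and bounded
above, see `objective_nonempty` and `objective_bddAbove`. -/
def value (Z : Fin k → EuclideanSpace ℝ (Fin d)) (x : EuclideanSpace ℝ (Fin d)) (r : ℝ) : ℝ :=
  sSup (objective '' {Y | Feasible Z x r Y})

lemma objective_nonempty (Z : Fin k → EuclideanSpace ℝ (Fin d)) (x : EuclideanSpace ℝ (Fin d))
    (r : ℝ) : (objective '' {Y | Feasible Z x r Y}).Nonempty := by
  refine ⟨_, Matrix.diagonal (fun a => Sum.elim (fun _ => (1 : ℝ)) (fun _ => 0) a), ?_, rfl⟩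
  refine ⟨by simp, by simp [blockB], by simp [blockU, Matrix.trace], ?_, ?_⟩
  · intro i
    have h : rowW (Matrix.diagonal (fun a : SDPIndex k d =>
        Sum.elim (fun _ => (1 : ℝ)) (fun _ => 0) a)) i = 0 := by
      ext j; simp [rowW]
    rw [h]; simp [blockb]
  · refine Matrix.PosSemidef.diagonal ?_
    rintro (a | a) <;> simp

lemma objective_bddAbove (Z : Fin k → EuclideanSpace ℝ (Fin d)) (x : EuclideanSpace ℝ (Fin d))
    (r : ℝ) : BddAbove (objective '' {Y | Feasible Z x r Y}) := by
  refine ⟨(1 / (k : ℝ)) * ∑ _i : Fin k, 1, ?_⟩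
  rintro _ ⟨Y, hY, rfl⟩
  refine mul_le_mul_of_nonneg_left (Finset.sum_le_sum fun i _ => ?_) (by positivity)
  have h := hY.posSemidef.dotProduct_mulVec_nonneg
    (Pi.single (.inl ()) (1 : ℝ) - Pi.single (.inr (.inl i)) 1)
  have hs : Y (.inl ()) (.inr (.inl i)) = Y (.inr (.inl i)) (.inl ()) := by
    simpa using hY.posSemidef.isHermitian.apply (.inr (.inl i)) (.inl ())
  have hd := hY.diag_le i
  have hc := hY.corner
  simp only [blockB, Matrix.of_apply] at hd
  simp [Matrix.mulVec_sub, sub_dotProduct, dotProduct_sub] at h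
  simp only [blockb]
  linarith

end CentralitySDP

/-- `x` is certifiably `(r, p)`-central with respect to `Z_1, …, Z_k`
(considered for `r > 0` and `p ∈ [0, 1]`). -/
def CertifiablyCentral {k d : ℕ} (Z : Fin k → EuclideanSpace ℝ (Fin d)) (r p : ℝ)
    (x : EuclideanSpace ℝ (Fin d)) : Prop :=
  CentralitySDP.value Z x r ≤ p

/-- The covariance matrix of a random vector in `ℝᵈ`. -/
def covMatrix {d : ℕ} {Ω : Type*} [MeasurableSpace Ω] (X : Ω → EuclideanSpace ℝ (Fin d))
    (P : Measure Ω) : Matrix (Fin d) (Fin d) ℝ :=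
  Matrix.of fun a b => cov[fun ω => X ω a, fun ω => X ω b; P]

/-- The `ℓ² → ℓ²` operator norm of a square matrix. -/
def matrixOpNorm {d : ℕ} (A : Matrix (Fin d) (Fin d) ℝ) : ℝ :=
  ‖Matrix.toEuclideanCLM (n := Fin d) (𝕜 := ℝ) A‖

end

/-! ### McDiarmid's inequality for i.i.d. coordinates. -/

section BoundedDifferences

variable {E : Type*} [MeasurableSpace E]

/-! Put X_i = Z_i - μ and write a feasible Y as a Gram matrix with vectors y_0, y_i (i ≤ k) and v_j
(j ≤ d). All y's have norm at most 1 and ∑ ‖v_j‖² ≤ 1, so Cauchy-Schwarz gives b_i ≤ 1, and the last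
constraint gives r b_i ≤ ‖∑_j X_ij v_j‖. Hence the SDP value is at most G(X), the supremum over such
v of the average of min(1, ‖∑_j X_ij v_j‖ / r) (`value_le_truncatedMeanSup`).

Because of the truncation, changing one X_i moves G by at most 1/k. McDiarmid's inequality then
gives the exponential tail under only two moments, and it remains to show E G ≤ 1/200.

For the expectation the truncation is dropped. Khintchine's inequality, applied to random signed
sums of the coordinates of the v_j, replaces vectors by scalars: ∑_i ‖∑_j X_ij v_j‖ ≤ (9/5) S with S
= sup over unit u of ∑_i |⟪X_i, u⟫| (`sum_norm_sum_smul_le`). The mean part of S is at most k √‖Σ‖.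
Its uniform deviation is at most 2 √(k Tr Σ), by symmetrization and contraction carried out one
coordinate at a time (`integral_deviationSup_le`). Dividing by k r gives the two terms in the
condition on r. -/

theorem measurable_finCons_prod (n : ℕ) :
    Measurable fun p : E × (Fin n → E) => (Fin.cons p.1 p.2 : Fin (n + 1) → E) := by
  refine measurable_pi_lambda _ fun i => ?_
  refine Fin.cases ?_ (fun j => ?_) i
  · simpa using measurable_fst
  · simp only [Fin.cons_succ]
    fun_prop

theorem measurePreserving_finCons (ν : Measure E) [SigmaFinite ν] (n : ℕ) :
    MeasurePreserving (fun p : E × (Fin n → E) => (Fin.cons p.1 p.2 : Fin (n + 1) → E))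
      (ν.prod (Measure.pi fun _ => ν)) (Measure.pi fun _ => ν) := by
  have h := (measurePreserving_piFinSuccAbove (fun _ : Fin (n + 1) => ν) 0).symm
  convert h using 1
  ext p : 1
  exact (Fin.insertNth_zero _ _).symm

/-- Hoeffding's lemma on the interval of radius c about g x₀. Its length is 2c although g oscillates
by at most c; this avoids locating the infimum of g and costs a factor 4 in the variance proxy. -/
theorem integral_exp_mul_le_of_abs_sub_le {ν : Measure E} [IsProbabilityMeasure ν] {c : ℝ}
    {g : E → ℝ} (hg : Measurable g) (hd : ∀ x y, |g x - g y| ≤ c) (t : ℝ) :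
    ∫ x, Real.exp (t * g x) ∂ν ≤ Real.exp (t * ∫ x, g x ∂ν + c ^ 2 * t ^ 2 / 2) := by
  obtain ⟨x₀⟩ := nonempty_of_isProbabilityMeasure ν
  have hc : 0 ≤ c := (abs_nonneg _).trans (hd x₀ x₀)
  have h := (hasSubgaussianMGF_of_mem_Icc (μ := ν) (a := g x₀ - c) (b := g x₀ + c)
    hg.aemeasurable (.of_forall fun x => by
      have := abs_le.1 (hd x x₀)
      constructor <;> linarith)).mgf_le t
  have hc' : (((‖(g x₀ + c) - (g x₀ - c)‖₊ / 2) ^ 2 : NNReal) : ℝ) = c ^ 2 := by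
    push_cast
    rw [show (g x₀ + c) - (g x₀ - c) = 2 * c by ring, Real.norm_eq_abs, abs_of_nonneg (by linarith)]
    ring
  rw [hc', mgf] at h
  have e : ∀ x, Real.exp (t * g x)
      = Real.exp (t * ∫ y, g y ∂ν) * Real.exp (t * (g x - ∫ y, g y ∂ν)) := fun x => by
    rw [← Real.exp_add]; ring_nf
  simp_rw [e, integral_const_mul, Real.exp_add]
  gcongr

/-- The moment generating function bound behind McDiarmid's inequality. -/
theorem integral_exp_mul_le_of_boundedDifferences {ν : Measure E} [IsProbabilityMeasure ν]
    {c M : ℝ} (t : ℝ) : ∀ (n : ℕ) {f : (Fin n → E) → ℝ}, Measurable f → (∀ x, |f x| ≤ M) →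
      (∀ x i y, |f (Function.update x i y) - f x| ≤ c) →
      ∫ x, Real.exp (t * f x) ∂(Measure.pi fun _ => ν)
        ≤ Real.exp (t * ∫ x, f x ∂(Measure.pi fun _ => ν) + n * (c ^ 2 * t ^ 2 / 2))
  | 0, f, _, _, _ => by
    rw [Measure.pi_of_empty]
    simp
  | n + 1, f, hf, hM, hd => by
    set κ : Measure (Fin n → E) := Measure.pi fun _ => ν with hκ
    have hcons := measurable_finCons_prod (E := E) n
    have hmp := measurePreserving_finCons ν n
    have hfc : Measurable fun p : E × (Fin n → E) => f (Fin.cons p.1 p.2) := hf.comp hcons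
    have hfx : ∀ x : E, Measurable fun y : Fin n → E => f (Fin.cons x y) := fun x =>
      hfc.comp measurable_prodMk_left
    have hintf : Integrable (fun p : E × (Fin n → E) => f (Fin.cons p.1 p.2)) (ν.prod κ) :=
      .of_bound hfc.aestronglyMeasurable M (.of_forall fun p => hM _)
    have hexpb : ∀ x, ‖Real.exp (t * f x)‖ ≤ Real.exp (|t| * M) := fun x => by
      rw [Real.norm_eq_abs, Real.abs_exp, Real.exp_le_exp]
      refine (le_abs_self _).trans ?_
      rw [abs_mul]
      exact mul_le_mul_of_nonneg_left (hM x) (abs_nonneg t)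
    have hexpm : Measurable fun p : E × (Fin n → E) => Real.exp (t * f (Fin.cons p.1 p.2)) :=
      (hfc.const_mul t).exp
    have hintexp : Integrable (fun p : E × (Fin n → E) => Real.exp (t * f (Fin.cons p.1 p.2)))
        (ν.prod κ) :=
      .of_bound hexpm.aestronglyMeasurable _ (.of_forall fun p => hexpb _)
    have e1 : ∫ x, Real.exp (t * f x) ∂(Measure.pi fun _ => ν)
        = ∫ x, ∫ y, Real.exp (t * f (Fin.cons x y)) ∂κ ∂ν := by
      rw [← hmp.map_eq, integral_map hcons.aemeasurable (by fun_prop), integral_prod _ hintexp]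
    have e2 : ∫ x, f x ∂(Measure.pi fun _ => ν) = ∫ x, ∫ y, f (Fin.cons x y) ∂κ ∂ν := by
      rw [← hmp.map_eq, integral_map hcons.aemeasurable (by fun_prop), integral_prod _ hintf]
    -- Averaging out all but the first coordinate keeps oscillation at most c. The induction
    -- hypothesis bounds the inner integral by exp(t F x) up to a constant, and Hoeffding's lemma
    -- handles F.
    set F : E → ℝ := fun x => ∫ y, f (Fin.cons x y) ∂κ with hF
    have hFm : Measurable F := (hfc.stronglyMeasurable.integral_prod_right').measurable
    have hintx : ∀ x, Integrable (fun y => f (Fin.cons x y)) κ := fun x =>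
      .of_bound (hfx x).aestronglyMeasurable M (.of_forall fun p => hM _)
    have hFd : ∀ x x', |F x - F x'| ≤ c := fun x x' => by
      rw [hF]
      simp only
      rw [← integral_sub (hintx x) (hintx x'), ← Real.norm_eq_abs]
      refine (norm_integral_le_of_norm_le_const (C := c) (.of_forall fun y => ?_)).trans (by simp)
      have := hd (Fin.cons x' y) 0 x
      rwa [Fin.update_cons_zero] at this
    have hFM : ∀ x, |F x| ≤ M := fun x => by
      rw [← Real.norm_eq_abs]
      exact (norm_integral_le_of_norm_le_const (C := M) (.of_forall fun y => hM _)).trans (by simp)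
    have hstep : ∀ x, ∫ y, Real.exp (t * f (Fin.cons x y)) ∂κ
        ≤ Real.exp (n * (c ^ 2 * t ^ 2 / 2)) * Real.exp (t * F x) := fun x => by
      refine (integral_exp_mul_le_of_boundedDifferences (c := c) t n (hfx x) (fun y => hM _)
        fun y i z => ?_).trans_eq ?_
      · have := hd (Fin.cons x y) i.succ z
        rwa [← Fin.cons_update] at this
      · rw [← Real.exp_add, add_comm]
    rw [e1, e2]
    calc ∫ x, ∫ y, Real.exp (t * f (Fin.cons x y)) ∂κ ∂ν
        ≤ ∫ x, Real.exp (n * (c ^ 2 * t ^ 2 / 2)) * Real.exp (t * F x) ∂ν := by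
          refine integral_mono hintexp.integral_prod_left ?_ hstep
          refine Integrable.const_mul ?_ _
          refine .of_bound ((hFm.const_mul t).exp).aestronglyMeasurable (Real.exp (|t| * M))
            (.of_forall fun x => ?_)
          rw [Real.norm_eq_abs, Real.abs_exp, Real.exp_le_exp]
          refine (le_abs_self _).trans ?_
          rw [abs_mul]
          exact mul_le_mul_of_nonneg_left (hFM x) (abs_nonneg t)
      _ ≤ Real.exp (n * (c ^ 2 * t ^ 2 / 2)) *
            Real.exp (t * ∫ x, F x ∂ν + c ^ 2 * t ^ 2 / 2) := by
          rw [integral_const_mul]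
          gcongr
          exact integral_exp_mul_le_of_abs_sub_le hFm hFd t
      _ = _ := by
          rw [← Real.exp_add]
          push_cast
          ring_nf

/-- **McDiarmid's inequality** (without the sharp constant) for i.i.d. coordinates. -/
theorem measureReal_ge_le_of_boundedDifferences {ν : Measure E} [IsProbabilityMeasure ν]
    {c M ε : ℝ} (hc : 0 < c) (hε : 0 ≤ ε) {n : ℕ} (hn : 0 < n) {f : (Fin n → E) → ℝ}
    (hf : Measurable f) (hM : ∀ x, |f x| ≤ M)
    (hd : ∀ x i y, |f (Function.update x i y) - f x| ≤ c) :
    (Measure.pi fun _ => ν).real {x | ∫ y, f y ∂(Measure.pi fun _ => ν) + ε ≤ f x}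
      ≤ Real.exp (-ε ^ 2 / (2 * n * c ^ 2)) := by
  have hn' : (0 : ℝ) < n := by exact_mod_cast hn
  -- The minimizer of the Chernoff exponent -tε + n c² t² / 2.
  set t : ℝ := ε / (n * c ^ 2) with ht
  have ht0 : 0 ≤ t := by positivity
  have hint : Integrable (fun x => Real.exp (t * f x)) (Measure.pi fun _ : Fin n => ν) := by
    refine .of_bound ((hf.const_mul t).exp).aestronglyMeasurable (Real.exp (|t| * M))
      (.of_forall fun x => ?_)
    rw [Real.norm_eq_abs, Real.abs_exp, Real.exp_le_exp]
    refine (le_abs_self _).trans ?_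
    rw [abs_mul]
    exact mul_le_mul_of_nonneg_left (hM x) (abs_nonneg t)
  refine (measure_ge_le_exp_mul_mgf _ ht0 hint).trans ?_
  refine (mul_le_mul_of_nonneg_left
    (integral_exp_mul_le_of_boundedDifferences t n hf hM hd) (Real.exp_nonneg _)).trans ?_
  rw [← Real.exp_add, Real.exp_le_exp, ht]
  apply le_of_eq
  field_simp
  ring

end BoundedDifferences

/-! ### Moments of Rademacher sums and Khintchine's inequality. -/

section Khintchine

/-- The Rademacher sum `∑ ± a_j` for a choice `ε` of signs. -/
def rademacherSum {n : ℕ} {V : Type*} [AddCommGroup V] (ε : Fin n → Bool) (a : Fin n → V) : V :=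
  ∑ j, if ε j then a j else -a j

theorem sum_fin_bool_succ {n : ℕ} (F : (Fin (n + 1) → Bool) → ℝ) :
    ∑ ε, F ε = ∑ ε : Fin n → Bool, (F (Fin.cons true ε) + F (Fin.cons false ε)) := by
  rw [← (Fin.consEquiv fun _ : Fin (n + 1) => Bool).sum_comp, Fintype.sum_prod_type]
  simp [Finset.sum_add_distrib, Fin.consEquiv]

theorem rademacherSum_cons {n : ℕ} {V : Type*} [AddCommGroup V] (b : Bool) (ε : Fin n → Bool)
    (a : Fin (n + 1) → V) :
    rademacherSum (Fin.cons b ε : Fin (n + 1) → Bool) a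
      = (if b then a 0 else -a 0) + rademacherSum ε (fun j => a j.succ) := by
  simp [rademacherSum, Fin.sum_univ_succ]

theorem map_rademacherSum {n : ℕ} {V W : Type*} [AddCommGroup V] [AddCommGroup W] (T : V →+ W)
    (ε : Fin n → Bool) (a : Fin n → V) :
    T (rademacherSum ε a) = rademacherSum ε fun j => T (a j) := by
  simp only [rademacherSum, map_sum]
  refine Finset.sum_congr rfl fun j _ => ?_
  split_ifs <;> simp

theorem sum_norm_rademacherSum_sq {V : Type*} [NormedAddCommGroup V] [InnerProductSpace ℝ V] :
    ∀ {n : ℕ} (a : Fin n → V),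
      ∑ ε : Fin n → Bool, ‖rademacherSum ε a‖ ^ 2 = 2 ^ n * ∑ j, ‖a j‖ ^ 2
  | 0, a => by simp [rademacherSum]
  | n + 1, a => by
    have ih := sum_norm_rademacherSum_sq fun j : Fin n => a j.succ
    rw [sum_fin_bool_succ, Fin.sum_univ_succ]
    have h : ∀ ε : Fin n → Bool, ‖rademacherSum (Fin.cons true ε : Fin (n + 1) → Bool) a‖ ^ 2
        + ‖rademacherSum (Fin.cons false ε : Fin (n + 1) → Bool) a‖ ^ 2
        = 2 * ‖a 0‖ ^ 2 + 2 * ‖rademacherSum ε fun j => a j.succ‖ ^ 2 := fun ε => by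
      simp only [rademacherSum_cons, if_true, Bool.false_eq_true, if_false]
      have := parallelogram_law_with_norm ℝ (rademacherSum ε fun j => a j.succ) (a 0)
      rw [neg_add_eq_sub, add_comm (a 0)]
      nlinarith
    simp_rw [h, Finset.sum_add_distrib, ← Finset.mul_sum, ih]
    simp only [Finset.sum_const, Finset.card_univ, Fintype.card_fun, Fintype.card_bool,
      Fintype.card_fin, nsmul_eq_mul]
    push_cast
    ring

theorem sum_rademacherSum_sq {n : ℕ} (a : Fin n → ℝ) :
    ∑ ε : Fin n → Bool, rademacherSum ε a ^ 2 = 2 ^ n * ∑ j, a j ^ 2 := by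
  simpa using sum_norm_rademacherSum_sq a

/-- Averaging over the first sign kills the odd powers and leaves a⁴ + 6a²s² + s⁴, with s the
remaining sum. This stays below 3(a² + q)² when s² averages to q and s⁴ to at most 3q². -/
theorem sum_rademacherSum_pow_four_le : ∀ {n : ℕ} (a : Fin n → ℝ),
    ∑ ε : Fin n → Bool, rademacherSum ε a ^ 4 ≤ 2 ^ n * (3 * (∑ j, a j ^ 2) ^ 2)
  | 0, a => by simp [rademacherSum]
  | n + 1, a => by
    have ih := sum_rademacherSum_pow_four_le fun j : Fin n => a j.succ
    have h2 := sum_rademacherSum_sq fun j : Fin n => a j.succ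
    rw [sum_fin_bool_succ, Fin.sum_univ_succ]
    have h : ∀ ε : Fin n → Bool, rademacherSum (Fin.cons true ε : Fin (n + 1) → Bool) a ^ 4
        + rademacherSum (Fin.cons false ε : Fin (n + 1) → Bool) a ^ 4
        = 2 * a 0 ^ 4 + (12 * a 0 ^ 2 * rademacherSum ε (fun j => a j.succ) ^ 2
          + 2 * rademacherSum ε (fun j => a j.succ) ^ 4) := fun ε => by
      simp only [rademacherSum_cons, if_true, Bool.false_eq_true, if_false]
      ring
    simp_rw [h, Finset.sum_add_distrib, ← Finset.mul_sum, h2]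
    simp only [Finset.sum_const, Finset.card_univ, Fintype.card_fun, Fintype.card_bool,
      Fintype.card_fin, nsmul_eq_mul]
    push_cast
    have : (0 : ℝ) ≤ 2 ^ n * a 0 ^ 4 := by positivity
    rw [pow_succ (2 : ℝ) n]
    nlinarith

/-- **Khintchine's inequality** between the first and the second moment. -/
theorem sqrt_sum_sq_le_sum_abs_rademacherSum {n : ℕ} (a : Fin n → ℝ) :
    2 ^ n * √(∑ j, a j ^ 2) ≤ 9 / 5 * ∑ ε : Fin n → Bool, |rademacherSum ε a| := by
  set q := ∑ j, a j ^ 2 with hq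
  have hq0 : 0 ≤ q := Finset.sum_nonneg fun j _ => sq_nonneg _
  rcases hq0.eq_or_lt with h0 | h0
  · rw [← h0, Real.sqrt_zero, mul_zero]
    positivity
  set s := √q with hs
  have hs0 : 0 < s := Real.sqrt_pos.2 h0
  have hss : s ^ 2 = q := Real.sq_sqrt hq0
  -- A quartic minorant of |x|, touching it at |x| = 3s/2. With second moment s² and fourth moment
  -- at most 3s⁴, the left side averages to at least (1 - 4/9) s⁴, whence the constant 9/5.
  have hpt : ∀ x : ℝ, s ^ 2 * x ^ 2 - 4 / 27 * x ^ 4 ≤ s ^ 3 * |x| := fun x => by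
    have h1 : 0 ≤ |x| * (|x| + 3 * s) * (|x| - 3 / 2 * s) ^ 2 := by positivity
    have h2 : x ^ 2 = |x| ^ 2 := (sq_abs x).symm
    have h4 : x ^ 4 = |x| ^ 4 := by rw [show x ^ 4 = (x ^ 2) ^ 2 by ring, h2]; ring
    rw [h2, h4]
    nlinarith
  have hsum := Finset.sum_le_sum fun (ε : Fin n → Bool) (_ : ε ∈ Finset.univ) =>
    hpt (rademacherSum ε a)
  rw [Finset.sum_sub_distrib, ← Finset.mul_sum, ← Finset.mul_sum, ← Finset.mul_sum,
    sum_rademacherSum_sq] at hsum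
  have h4 := sum_rademacherSum_pow_four_le a
  rw [← hq, ← hss] at hsum h4
  have : s ^ 3 * (5 / 9 * (2 ^ n * s)) ≤ s ^ 3 * ∑ ε : Fin n → Bool, |rademacherSum ε a| := by
    nlinarith
  have := le_of_mul_le_mul_left this (by positivity)
  linarith

end Khintchine

/-! ### Uniform deviation over the unit ball: symmetrization and contraction. -/

section Deviation

variable {E : Type*} [NormedAddCommGroup E] [InnerProductSpace ℝ E]

theorem abs_inner_closedBall_le (x : E) (u : Metric.closedBall (0 : E) 1) :
    |inner ℝ x (u : E)| ≤ ‖x‖ := by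
  refine (abs_real_inner_le_norm _ _).trans (mul_le_of_le_one_right (norm_nonneg _) ?_)
  exact mem_closedBall_zero_iff.1 u.2

/-- The centre of the closed unit ball. -/
def unitBallZero : Metric.closedBall (0 : E) 1 := ⟨0, by simp⟩

instance : Nonempty (Metric.closedBall (0 : E) 1) := ⟨unitBallZero⟩

/-- The supremum over the unit ball of the empirical deviation of `|⟪x, u⟫|` from `m u`, tilted
by the linear functional `⟪w, u⟫`. -/
noncomputable def deviationSup (m : E → ℝ) {n : ℕ} (w : E) (X : Fin n → E) : ℝ :=
  ⨆ u : Metric.closedBall (0 : E) 1,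
    (inner ℝ w (u : E) + ∑ i, (|inner ℝ (X i) (u : E)| - m u))

variable {m : E → ℝ} {n : ℕ}

theorem deviation_le (hm : ∀ u, 0 ≤ m u) (w : E) (X : Fin n → E)
    (u : Metric.closedBall (0 : E) 1) :
    inner ℝ w (u : E) + ∑ i, (|inner ℝ (X i) (u : E)| - m u) ≤ ‖w‖ + ∑ i, ‖X i‖ :=
  add_le_add ((le_abs_self _).trans (abs_inner_closedBall_le w u))
    (Finset.sum_le_sum fun i _ => by
      have := abs_inner_closedBall_le (X i) u
      have := hm u
      linarith)

theorem bddAbove_deviation (hm : ∀ u, 0 ≤ m u) (w : E) (X : Fin n → E) :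
    BddAbove (Set.range fun u : Metric.closedBall (0 : E) 1 =>
      inner ℝ w (u : E) + ∑ i, (|inner ℝ (X i) (u : E)| - m u)) :=
  ⟨_, Set.forall_mem_range.2 (deviation_le hm w X)⟩

theorem deviationSup_le (hm : ∀ u, 0 ≤ m u) (w : E) (X : Fin n → E) :
    deviationSup m w X ≤ ‖w‖ + ∑ i, ‖X i‖ :=
  ciSup_le (deviation_le hm w X)

theorem deviationSup_nonneg (hm : ∀ u, 0 ≤ m u) (hm0 : m 0 = 0) (w : E) (X : Fin n → E) :
    0 ≤ deviationSup m w X := by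
  refine le_trans (le_of_eq ?_) (le_ciSup (bddAbove_deviation hm w X) unitBallZero)
  simp [unitBallZero, hm0]

variable [MeasurableSpace E] [BorelSpace E] [SecondCountableTopology E]

/-- A supremum of continuous functions is lower semicontinuous, so the uncountable index set does no
harm and `m` need not be continuous. -/
theorem measurable_deviationSup (hm : ∀ u, 0 ≤ m u) :
    Measurable fun p : E × (Fin n → E) => deviationSup m p.1 p.2 := by
  refine LowerSemicontinuous.measurable
    (lowerSemicontinuous_ciSup (fun p => bddAbove_deviation hm p.1 p.2) fun u => ?_)
  exact Continuous.lowerSemicontinuous (by fun_prop)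

theorem measurable_deviationSup_right (hm : ∀ u, 0 ≤ m u) (w : E) :
    Measurable fun X : Fin n → E => deviationSup m w X :=
  (measurable_deviationSup hm).comp (measurable_const.prodMk measurable_id)

variable {ν : Measure E} [IsProbabilityMeasure ν]

-- Common integrability statement for the suprema met in symmetrization: the value at u = 0 bounds
-- them below, linear growth in ‖x‖ above.
omit [InnerProductSpace ℝ E] [SecondCountableTopology E] in
theorem integrable_iSup_add {g : Metric.closedBall (0 : E) 1 → ℝ} (hg : BddAbove (Set.range g))
    {φ : Metric.closedBall (0 : E) 1 → E → ℝ} (hφ : ∀ u, Continuous (φ u))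
    (hφ0 : ∀ x, φ unitBallZero x = 0) (hφle : ∀ u x, φ u x ≤ 2 * ‖x‖)
    (hint : Integrable (fun x : E => x) ν) :
    (∀ x, BddAbove (Set.range fun u => g u + φ u x)) ∧
      Integrable (fun x => ⨆ u, (g u + φ u x)) ν := by
  obtain ⟨K, hK⟩ := hg
  have hle : ∀ x u, g u + φ u x ≤ K + 2 * ‖x‖ := fun x u =>
    add_le_add (hK (Set.mem_range_self u)) (hφle u x)
  have hbdd : ∀ x, BddAbove (Set.range fun u => g u + φ u x) := fun x =>
    ⟨_, Set.forall_mem_range.2 (hle x)⟩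
  refine ⟨hbdd, ?_⟩
  have hmeas : Measurable fun x => ⨆ u, (g u + φ u x) :=
    LowerSemicontinuous.measurable (lowerSemicontinuous_ciSup hbdd fun u =>
      (continuous_const.add (hφ u)).lowerSemicontinuous)
  refine Integrable.mono' (g := fun x => |K| + |g unitBallZero| + 2 * ‖x‖)
    ((integrable_const _).add (hint.norm.const_mul 2)) hmeas.aestronglyMeasurable
    (.of_forall fun x => ?_)
  rw [Real.norm_eq_abs, abs_le]
  have h1 : (⨆ u, (g u + φ u x)) ≤ K + 2 * ‖x‖ := ciSup_le (hle x)
  have h2 : g unitBallZero + φ unitBallZero x ≤ ⨆ u, (g u + φ u x) := le_ciSup (hbdd x) unitBallZero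
  rw [hφ0, add_zero] at h2
  have := neg_abs_le (g unitBallZero)
  have := le_abs_self K
  have := abs_nonneg K
  have := abs_nonneg (g unitBallZero)
  have := norm_nonneg x
  constructor <;> linarith

omit [SecondCountableTopology E] in
/-- Symmetrization and contraction for a single coordinate. -/
theorem integral_iSup_abs_inner_sub_le {g : Metric.closedBall (0 : E) 1 → ℝ}
    (hg : BddAbove (Set.range g)) (hint : Integrable (fun x : E => x) ν) :
    ∫ x, (⨆ u : Metric.closedBall (0 : E) 1,
        (g u + (|inner ℝ x (u : E)| - ∫ y, |inner ℝ y (u : E)| ∂ν))) ∂ν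
      ≤ ∫ x, ((⨆ u : Metric.closedBall (0 : E) 1, (g u + inner ℝ ((2 : ℝ) • x) (u : E)))
        + ⨆ u : Metric.closedBall (0 : E) 1, (g u + inner ℝ (-((2 : ℝ) • x)) (u : E))) / 2 ∂ν := by
  have hinner : ∀ u : E, Integrable (fun x => |inner ℝ x u|) ν := fun u =>
    (hint.inner_const u).abs
  have hb := fun (x : E) u => abs_inner_closedBall_le x u
  obtain ⟨-, hI0⟩ := integrable_iSup_add hg
    (φ := fun u x => |inner ℝ x (u : E)| - ∫ y, |inner ℝ y (u : E)| ∂ν)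
    (fun u => by fun_prop) (fun x => by simp [unitBallZero])
    (fun u x => by
      have := hb x u
      have : 0 ≤ ∫ y, |inner ℝ y (u : E)| ∂ν := integral_nonneg fun _ => abs_nonneg _
      have := norm_nonneg x
      linarith) hint
  obtain ⟨hBT, hIT⟩ := integrable_iSup_add hg (φ := fun u x => 2 * |inner ℝ x (u : E)|)
    (fun u => by fun_prop) (fun x => by simp [unitBallZero])
    (fun u x => by have := hb x u; linarith) hint
  obtain ⟨hBT', hIT'⟩ := integrable_iSup_add hg (φ := fun u x => -(2 * |inner ℝ x (u : E)|))
    (fun u => by fun_prop) (fun x => by simp [unitBallZero])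
    (fun u x => by
      have := abs_nonneg (inner ℝ x (u : E))
      have := norm_nonneg x
      linarith) hint
  obtain ⟨hBS, hIS⟩ := integrable_iSup_add hg (φ := fun u x => inner ℝ ((2 : ℝ) • x) (u : E))
    (fun u => by fun_prop) (fun x => by simp [unitBallZero])
    (fun u x => by
      have := (le_abs_self _).trans (hb ((2 : ℝ) • x) u)
      rwa [norm_smul, Real.norm_two] at this) hint
  obtain ⟨hBS', hIS'⟩ := integrable_iSup_add hg (φ := fun u x => inner ℝ (-((2 : ℝ) • x)) (u : E))
    (fun u => by fun_prop) (fun x => by simp [unitBallZero])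
    (fun u x => by
      have := (le_abs_self _).trans (hb (-((2 : ℝ) • x)) u)
      rwa [norm_neg, norm_smul, Real.norm_two] at this) hint
  set T : E → ℝ := fun x => ⨆ u, (g u + 2 * |inner ℝ x (u : E)|) with hT
  set T' : E → ℝ := fun x => ⨆ u, (g u + -(2 * |inner ℝ x (u : E)|)) with hT'
  set S : E → ℝ := fun x => ⨆ u : Metric.closedBall (0 : E) 1,
    (g u + inner ℝ ((2 : ℝ) • x) (u : E)) with hS
  set S' : E → ℝ := fun x => ⨆ u : Metric.closedBall (0 : E) 1,
    (g u + inner ℝ (-((2 : ℝ) • x)) (u : E)) with hS'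
  -- Contraction: given u and v, let s be the sign of ⟪x, u⟫. Then 2|⟪x, u⟫| = 2s⟪x, u⟫ and -2|⟪x,
  -- v⟫| ≤ -2s⟪x, v⟫, so one term falls under `S` and the other under `S'`.
  have hcontr : ∀ x, T x + T' x ≤ S x + S' x := fun x => by
    have key : ∀ u v : Metric.closedBall (0 : E) 1, g u + 2 * |inner ℝ x (u : E)|
        + (g v + -(2 * |inner ℝ x (v : E)|)) ≤ S x + S' x := fun u v => by
      have hu := le_ciSup (hBS x) u
      have hv := le_ciSup (hBS x) v
      have hu' := le_ciSup (hBS' x) u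
      have hv' := le_ciSup (hBS' x) v
      simp only [inner_neg_left, real_inner_smul_left] at hu hv hu' hv'
      have e : S' x = ⨆ u : Metric.closedBall (0 : E) 1, (g u + -(2 * inner ℝ x (u : E))) := by
        simp only [hS', inner_neg_left, real_inner_smul_left]
      have e' : S x = ⨆ u : Metric.closedBall (0 : E) 1, (g u + 2 * inner ℝ x (u : E)) := by
        simp only [hS, real_inner_smul_left]
      rw [← e] at hu' hv'
      rw [← e'] at hu hv
      rcases abs_cases (inner ℝ x (u : E)) with ⟨h1, -⟩ | ⟨h1, -⟩ <;> rw [h1] <;>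
        linarith [neg_abs_le (inner ℝ x (v : E)), le_abs_self (inner ℝ x (v : E))]
    have h1 : T x ≤ S x + S' x - T' x := ciSup_le fun u => by
      have : T' x ≤ S x + S' x - (g u + 2 * |inner ℝ x (u : E)|) := ciSup_le fun v => by
        linarith [key u v]
      linarith
    linarith
  -- Symmetrization: g + (a - m) is the mean of g + 2a and g - 2m, and the latter is at most the
  -- integral of `T'`, the ghost copy. After integration `T` and `T'` may be taken at the same
  -- point.
  have hpt : ∀ x, (⨆ u : Metric.closedBall (0 : E) 1,
      (g u + (|inner ℝ x (u : E)| - ∫ y, |inner ℝ y (u : E)| ∂ν)))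
      ≤ (T x + ∫ y, T' y ∂ν) / 2 := fun x => ciSup_le fun u => by
    have h1 : g u + 2 * |inner ℝ x (u : E)| ≤ T x := le_ciSup (hBT x) u
    have hneg : Integrable (fun y => -(2 * |inner ℝ y (u : E)|)) ν := ((hinner u).const_mul 2).neg
    have h2 : g u - 2 * ∫ y, |inner ℝ y (u : E)| ∂ν ≤ ∫ y, T' y ∂ν := by
      have : ∫ y, (g u + -(2 * |inner ℝ y (u : E)|)) ∂ν ≤ ∫ y, T' y ∂ν :=
        integral_mono ((integrable_const _).add hneg) hIT'
          fun y => le_ciSup (hBT' y) u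
      rw [integral_add (integrable_const _) hneg, integral_neg, integral_const_mul] at this
      simpa [sub_eq_add_neg] using this
    linarith
  calc _ ≤ ∫ x, (T x + ∫ y, T' y ∂ν) / 2 ∂ν :=
        integral_mono hI0 ((hIT.add (integrable_const _)).div_const 2) hpt
    _ = ∫ x, (T x + T' x) / 2 ∂ν := by
        rw [integral_div, integral_div, integral_add hIT (integrable_const _), integral_add hIT hIT']
        simp
    _ ≤ _ := integral_mono ((hIT.add hIT').div_const 2) ((hIS.add hIS').div_const 2) fun x => by
        exact div_le_div_of_nonneg_right (hcontr x) zero_le_two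

-- Jensen's inequality, from integrating (√f - a)² ≥ 0 with a the mean of √f.
omit [NormedAddCommGroup E] [InnerProductSpace ℝ E] [BorelSpace E]
  [SecondCountableTopology E] in
theorem integral_sqrt_le_sqrt_integral {f : E → ℝ} (hf0 : ∀ x, 0 ≤ f x) (hf : Integrable f ν) :
    ∫ x, √(f x) ∂ν ≤ √(∫ x, f x ∂ν) := by
  have hI : Integrable (fun x => √(f x)) ν := by
    refine Integrable.mono' (hf.add (integrable_const 1))
      (hf.aestronglyMeasurable.aemeasurable.sqrt).aestronglyMeasurable (.of_forall fun x => ?_)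
    rw [Real.norm_eq_abs, abs_of_nonneg (Real.sqrt_nonneg _)]
    have := Real.sq_sqrt (hf0 x)
    simp only [Pi.add_apply]
    nlinarith [sq_nonneg (√(f x) - 1)]
  refine Real.le_sqrt_of_sq_le ?_
  set a := ∫ x, √(f x) ∂ν
  have h : ∫ x, (2 * a * √(f x) - a ^ 2) ∂ν ≤ ∫ x, f x ∂ν :=
    integral_mono ((hI.const_mul _).sub (integrable_const _)) hf fun x => by
      have := Real.sq_sqrt (hf0 x)
      simp only
      nlinarith [sq_nonneg (√(f x) - a)]
  rw [integral_sub (hI.const_mul _) (integrable_const _), integral_const_mul] at h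
  simp only [integral_const, probReal_univ, one_smul] at h
  change 2 * a * a - a ^ 2 ≤ _ at h
  linarith

omit [InnerProductSpace ℝ E] [BorelSpace E] [SecondCountableTopology E] in
theorem integrable_sum_norm_pi (hint : Integrable (fun x : E => x) ν) (n : ℕ) :
    Integrable (fun X : Fin n → E => ∑ i, ‖X i‖) (Measure.pi fun _ => ν) :=
  integrable_finsetSum _ fun i _ => (integrable_comp_eval (μ := fun _ : Fin n => ν) (i := i)
    (f := fun x : E => ‖x‖) hint.norm)

/-- The expected uniform deviation of `|⟪x, u⟫|` over the unit ball. -/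
theorem integral_deviationSup_le (hint : Integrable (fun x : E => x) ν)
    (hint2 : Integrable (fun x : E => ‖x‖ ^ 2) ν) : ∀ (n : ℕ) (w : E),
    ∫ X : Fin n → E, deviationSup (fun u => ∫ y, |inner ℝ y u| ∂ν) w X ∂(Measure.pi fun _ => ν)
      ≤ √(‖w‖ ^ 2 + 4 * n * ∫ x, ‖x‖ ^ 2 ∂ν)
  | 0, w => by
    have hm : ∀ u : E, 0 ≤ ∫ y, |inner ℝ y u| ∂ν := fun u => integral_nonneg fun _ => abs_nonneg _
    rw [Measure.pi_of_empty, integral_dirac]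
    refine (deviationSup_le hm w _).trans ?_
    simp
  | n + 1, w => by
    set m : E → ℝ := fun u => ∫ y, |inner ℝ y u| ∂ν with hmdef
    have hm : ∀ u : E, 0 ≤ m u := fun u => integral_nonneg fun _ => abs_nonneg _
    have hm0 : m 0 = 0 := by simp [hmdef]
    set κ : Measure (Fin n → E) := Measure.pi fun _ => ν with hκ
    set τ := ∫ x, ‖x‖ ^ 2 ∂ν with hτ
    have hτ0 : 0 ≤ τ := integral_nonneg fun _ => by positivity
    have hcons := measurable_finCons_prod (E := E) n
    have hmp := measurePreserving_finCons ν n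
    have hbound : Integrable (fun p : E × (Fin n → E) => ‖w‖ + 2 * ‖p.1‖ + ∑ i, ‖p.2 i‖)
        (ν.prod κ) :=
      ((integrable_const _).add ((hint.norm.const_mul 2).comp_fst κ)).add
        ((integrable_sum_norm_pi hint n).comp_snd ν)
    have hA : Integrable (fun p : E × (Fin n → E) =>
        deviationSup m w (Fin.cons p.1 p.2 : Fin (n + 1) → E)) (ν.prod κ) := by
      refine hbound.mono' ((measurable_deviationSup hm).comp
        (measurable_const.prodMk hcons)).aestronglyMeasurable (.of_forall fun p => ?_)
      rw [Real.norm_eq_abs, abs_of_nonneg (deviationSup_nonneg hm hm0 _ _)]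
      refine (deviationSup_le hm _ _).trans ?_
      simp only [Fin.sum_univ_succ, Fin.cons_zero, Fin.cons_succ]
      linarith [norm_nonneg p.1]
    have hAs : ∀ s : ℝ, |s| = 2 → Integrable (fun p : E × (Fin n → E) =>
        deviationSup m (w + s • p.1) p.2) (ν.prod κ) := fun s hs => by
      refine hbound.mono' ((measurable_deviationSup hm).comp
        (Measurable.prodMk (by fun_prop) measurable_snd)).aestronglyMeasurable
        (.of_forall fun p => ?_)
      rw [Real.norm_eq_abs, abs_of_nonneg (deviationSup_nonneg hm hm0 _ _)]
      refine (deviationSup_le hm _ _).trans ?_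
      have := norm_add_le w (s • p.1)
      rw [norm_smul, Real.norm_eq_abs, hs] at this
      linarith
    have hA1 := hAs 2 (by norm_num)
    have hA2 := hAs (-2) (by norm_num)
    -- With the other coordinates frozen, the symmetrized first term is linear in u and is absorbed
    -- into the tilt, which becomes w ± 2x.
    have hstep : ∀ X : Fin n → E, ∫ x, deviationSup m w (Fin.cons x X : Fin (n + 1) → E) ∂ν
        ≤ ∫ x, (deviationSup m (w + (2 : ℝ) • x) X + deviationSup m (w + (-2 : ℝ) • x) X) / 2 ∂ν :=
      fun X => by
      refine le_of_eq_of_le ?_ ((integral_iSup_abs_inner_sub_le (bddAbove_deviation hm w X)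
        hint).trans_eq ?_)
      · refine integral_congr_ae (.of_forall fun x => ?_)
        simp only [deviationSup, Fin.sum_univ_succ, Fin.cons_zero, Fin.cons_succ]
        congr 1
        ext u
        ring
      · refine integral_congr_ae (.of_forall fun x => ?_)
        simp only [deviationSup, inner_add_left, neg_smul]
        congr 2 <;> · congr 1; ext u; ring
    have ih := integral_deviationSup_le hint hint2 n
    have hI1 : Integrable (fun p : E × (Fin n → E) => (deviationSup m (w + (2 : ℝ) • p.1) p.2
      + deviationSup m (w + (-2 : ℝ) • p.1) p.2) / 2) (ν.prod κ) := (hA1.add hA2).div_const 2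
    have hpar : Integrable (fun x : E => ‖w‖ ^ 2 + 4 * ‖x‖ ^ 2 + 4 * n * τ) ν :=
      ((integrable_const _).add (hint2.const_mul 4)).add (integrable_const _)
    -- The parallelogram law averages ‖w ± 2x‖² to ‖w‖² + 4‖x‖², and concavity of the square root
    -- moves the average inside: each coordinate adds 4‖x‖² under the root.
    have hsec : ∀ᵐ x ∂ν, ∫ X, (deviationSup m (w + (2 : ℝ) • x) X
        + deviationSup m (w + (-2 : ℝ) • x) X) / 2 ∂κ ≤ √(‖w‖ ^ 2 + 4 * ‖x‖ ^ 2 + 4 * n * τ) := by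
      filter_upwards [hA1.prod_right_ae, hA2.prod_right_ae] with x h1 h2
      rw [integral_div, integral_add h1 h2]
      have i1 := ih (w + (2 : ℝ) • x)
      have i2 := ih (w + (-2 : ℝ) • x)
      refine (div_le_div_of_nonneg_right (add_le_add i1 i2) zero_le_two).trans ?_
      refine Real.le_sqrt_of_sq_le ?_
      have hp := parallelogram_law_with_norm ℝ w ((2 : ℝ) • x)
      rw [show w - (2 : ℝ) • x = w + (-2 : ℝ) • x by rw [neg_smul, sub_eq_add_neg],
        norm_smul, Real.norm_two] at hp
      have s1 := Real.sq_sqrt (show 0 ≤ ‖w + (2 : ℝ) • x‖ ^ 2 + 4 * n * τ by positivity)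
      have s2 := Real.sq_sqrt (show 0 ≤ ‖w + (-2 : ℝ) • x‖ ^ 2 + 4 * n * τ by positivity)
      nlinarith [sq_nonneg (√(‖w + (2 : ℝ) • x‖ ^ 2 + 4 * n * τ)
        - √(‖w + (-2 : ℝ) • x‖ ^ 2 + 4 * n * τ))]
    calc ∫ X, deviationSup m w X ∂(Measure.pi fun _ => ν)
        = ∫ X, ∫ x, deviationSup m w (Fin.cons x X : Fin (n + 1) → E) ∂ν ∂κ := by
          rw [← hmp.map_eq, integral_map hcons.aemeasurable (measurable_deviationSup_right hm w).aestronglyMeasurable,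
            integral_prod_symm _ hA]
      _ ≤ ∫ X, ∫ x, (deviationSup m (w + (2 : ℝ) • x) X
            + deviationSup m (w + (-2 : ℝ) • x) X) / 2 ∂ν ∂κ :=
          integral_mono hA.integral_prod_right hI1.integral_prod_right hstep
      _ = ∫ x, ∫ X, (deviationSup m (w + (2 : ℝ) • x) X
            + deviationSup m (w + (-2 : ℝ) • x) X) / 2 ∂κ ∂ν := by
          rw [← integral_prod_symm _ hI1, integral_prod _ hI1]
      _ ≤ ∫ x, √(‖w‖ ^ 2 + 4 * ‖x‖ ^ 2 + 4 * n * τ) ∂ν := by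
          refine integral_mono_ae hI1.integral_prod_left ?_ hsec
          refine Integrable.mono' (hpar.add (integrable_const 1))
            (by fun_prop) (.of_forall fun x => ?_)
          rw [Real.norm_eq_abs, abs_of_nonneg (Real.sqrt_nonneg _)]
          have := Real.sq_sqrt (show 0 ≤ ‖w‖ ^ 2 + 4 * ‖x‖ ^ 2 + 4 * n * τ by positivity)
          simp only [Pi.add_apply]
          nlinarith [sq_nonneg (√(‖w‖ ^ 2 + 4 * ‖x‖ ^ 2 + 4 * n * τ) - 1)]
      _ ≤ √(∫ x, (‖w‖ ^ 2 + 4 * ‖x‖ ^ 2 + 4 * n * τ) ∂ν) :=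
          integral_sqrt_le_sqrt_integral (fun x => by positivity) hpar
      _ = _ := by
          have h4 : Integrable (fun x : E => ‖w‖ ^ 2 + 4 * ‖x‖ ^ 2) ν :=
            (integrable_const _).add (hint2.const_mul 4)
          rw [integral_add h4 (integrable_const _), integral_add (integrable_const _) (hint2.const_mul 4), integral_const_mul, ← hτ]
          simp only [integral_const, probReal_univ, one_smul]
          push_cast
          ring_nf

end Deviation

/-! ### The vector relaxation: comparison with scalars and bounded differences. -/

section GramRelaxation

variable {k d : ℕ}

/-- A Grothendieck-type inequality: replacing scalars by vectors in the `ℓ² → ℓ¹` operator norm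
costs only a constant factor. -/
theorem sum_norm_sum_smul_le {N : ℕ} {X : Fin k → EuclideanSpace ℝ (Fin d)} {S : ℝ} (hS0 : 0 ≤ S)
    (hS : ∀ u, ∑ i, |inner ℝ (X i) u| ≤ S * ‖u‖) {v : Fin d → EuclideanSpace ℝ (Fin N)}
    (hv : ∑ j, ‖v j‖ ^ 2 ≤ 1) :
    ∑ i, ‖∑ j, X i j • v j‖ ≤ 9 / 5 * S := by
  -- The columns of v: the coordinates of ∑_j X_ij v_j are ⟪X_i, c_p⟫. By Khintchine its norm is at
  -- most 9/5 times the average of |⟪X_i, ∑ ± c_p⟫|, and the random test vector ∑ ± c_p has mean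
  -- square norm at most 1.
  set c : Fin N → EuclideanSpace ℝ (Fin d) := fun p => WithLp.toLp 2 fun j => v j p with hc
  have hcv : ∑ p, ‖c p‖ ^ 2 ≤ 1 := by
    refine le_trans (le_of_eq ?_) hv
    simp only [EuclideanSpace.norm_sq_eq, hc]
    exact Finset.sum_comm
  have hz : ∀ i p, (∑ j, X i j • v j) p = inner ℝ (X i) (c p) := fun i p => by
    simp only [PiLp.inner_apply, hc, WithLp.ofLp_sum, Finset.sum_apply,
      smul_eq_mul, RCLike.inner_apply, conj_trivial, WithLp.ofLp_smul, Pi.smul_apply]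
    exact Finset.sum_congr rfl fun j _ => mul_comm _ _
  have hK : ∀ i, 2 ^ N * ‖∑ j, X i j • v j‖
      ≤ 9 / 5 * ∑ ε : Fin N → Bool, |inner ℝ (X i) (rademacherSum ε c)| := fun i => by
    have h := sqrt_sum_sq_le_sum_abs_rademacherSum fun p => (∑ j, X i j • v j) p
    have e : ∀ ε : Fin N → Bool, inner ℝ (X i) (rademacherSum ε c)
        = rademacherSum ε fun p => (∑ j, X i j • v j) p := fun ε => by
      simp_rw [hz]
      exact map_rademacherSum (innerSL ℝ (X i)).toLinearMap.toAddMonoidHom ε c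
    simp_rw [e]
    rw [EuclideanSpace.norm_eq]
    simpa only [Real.norm_eq_abs, sq_abs] using h
  have hsum := Finset.sum_le_sum fun i (_ : i ∈ Finset.univ) => hK i
  rw [← Finset.mul_sum, ← Finset.mul_sum, Finset.sum_comm] at hsum
  have h2 : ∑ ε : Fin N → Bool, ∑ i, |inner ℝ (X i) (rademacherSum ε c)| ≤ S * 2 ^ N := by
    refine (Finset.sum_le_sum fun ε _ => hS _).trans ?_
    rw [← Finset.mul_sum]
    refine mul_le_mul_of_nonneg_left ?_ hS0
    have h3 : ∑ ε : Fin N → Bool, ‖rademacherSum ε c‖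
        ≤ ∑ ε : Fin N → Bool, (1 + ‖rademacherSum ε c‖ ^ 2) / 2 :=
      Finset.sum_le_sum fun ε _ => by nlinarith [sq_nonneg (‖rademacherSum ε c‖ - 1)]
    refine h3.trans ?_
    rw [← Finset.sum_div, Finset.sum_add_distrib, sum_norm_rademacherSum_sq]
    simp only [Finset.sum_const, Finset.card_univ, Fintype.card_fun, Fintype.card_bool,
      Fintype.card_fin, nsmul_eq_mul]
    push_cast
    have : (0 : ℝ) < 2 ^ N := by positivity
    nlinarith
  have : 2 ^ N * ∑ i, ‖∑ j, X i j • v j‖ ≤ 2 ^ N * (9 / 5 * S) := by linarith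
  exact le_of_mul_le_mul_left this (by positivity)

/-- Families of `d` vectors in `ℝᴺ` of Frobenius norm at most `1`. -/
def FrobeniusBall (d N : ℕ) : Type :=
  {v : Fin d → EuclideanSpace ℝ (Fin N) // ∑ j, ‖v j‖ ^ 2 ≤ 1}

instance (d N : ℕ) : Nonempty (FrobeniusBall d N) := ⟨⟨0, by simp⟩⟩

/-- The average truncated length of the images of the points `X i` under a linear map. -/
noncomputable def truncatedMean {N : ℕ} (r : ℝ) (v : FrobeniusBall d N)
    (X : Fin k → EuclideanSpace ℝ (Fin d)) : ℝ :=
  1 / (k : ℝ) * ∑ i, min 1 (‖∑ j, X i j • v.1 j‖ / r)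

/-- The supremum of `truncatedMean` over the Frobenius ball. -/
noncomputable def truncatedMeanSup (N : ℕ) (r : ℝ) (X : Fin k → EuclideanSpace ℝ (Fin d)) : ℝ :=
  ⨆ v : FrobeniusBall d N, truncatedMean r v X

variable {N : ℕ} {r : ℝ}

theorem truncatedMean_nonneg (hr : 0 < r) (v : FrobeniusBall d N)
    (X : Fin k → EuclideanSpace ℝ (Fin d)) : 0 ≤ truncatedMean r v X :=
  mul_nonneg (by positivity) (Finset.sum_nonneg fun i _ => le_min zero_le_one (by positivity))

theorem truncatedMean_le_one (v : FrobeniusBall d N)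
    (X : Fin k → EuclideanSpace ℝ (Fin d)) : truncatedMean r v X ≤ 1 := by
  rw [truncatedMean, one_div]
  calc (k : ℝ)⁻¹ * ∑ i, min 1 (‖∑ j, X i j • v.1 j‖ / r) ≤ (k : ℝ)⁻¹ * ∑ _i : Fin k, 1 := by
        gcongr
        exact min_le_left _ _
    _ ≤ 1 := by simpa using inv_mul_le_one

theorem bddAbove_truncatedMean (X : Fin k → EuclideanSpace ℝ (Fin d)) :
    BddAbove (Set.range fun v : FrobeniusBall d N => truncatedMean r v X) :=
  ⟨1, Set.forall_mem_range.2 fun v => truncatedMean_le_one v X⟩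

theorem truncatedMeanSup_nonneg (hr : 0 < r) (X : Fin k → EuclideanSpace ℝ (Fin d)) :
    0 ≤ truncatedMeanSup N r X :=
  Real.iSup_nonneg fun v => truncatedMean_nonneg hr v X

theorem abs_truncatedMeanSup_le_one (hr : 0 < r) (X : Fin k → EuclideanSpace ℝ (Fin d)) :
    |truncatedMeanSup N r X| ≤ 1 := by
  rw [abs_of_nonneg (truncatedMeanSup_nonneg hr X)]
  exact ciSup_le fun v => truncatedMean_le_one v X

theorem measurable_truncatedMeanSup :
    Measurable (truncatedMeanSup (k := k) (d := d) N r) := by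
  refine LowerSemicontinuous.measurable
    (lowerSemicontinuous_ciSup (fun X => bddAbove_truncatedMean X) fun v => ?_)
  refine Continuous.lowerSemicontinuous ?_
  unfold truncatedMean
  fun_prop

/-- Only one summand changes, and truncation keeps it in [0, 1]; an untruncated point could have
unbounded influence. -/
theorem truncatedMean_update_le (hr : 0 < r) (v : FrobeniusBall d N)
    (X : Fin k → EuclideanSpace ℝ (Fin d)) (i : Fin k) (y : EuclideanSpace ℝ (Fin d)) :
    |truncatedMean r v (Function.update X i y) - truncatedMean r v X| ≤ 1 / k := by
  rw [truncatedMean, truncatedMean, ← mul_sub, abs_mul, abs_of_nonneg (by positivity),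
    ← Finset.sum_sub_distrib]
  refine mul_le_of_le_one_right (by positivity) ?_
  rw [Finset.sum_eq_single i (fun j _ hj => by rw [Function.update_of_ne hj, sub_self])
    (fun h => absurd (Finset.mem_univ i) h)]
  have h : ∀ x : EuclideanSpace ℝ (Fin d), 0 ≤ min 1 (‖∑ j, x j • v.1 j‖ / r) := fun x =>
    le_min zero_le_one (by positivity)
  have h' : ∀ x : EuclideanSpace ℝ (Fin d), min 1 (‖∑ j, x j • v.1 j‖ / r) ≤ 1 := fun x =>
    min_le_left _ _
  rw [abs_le]
  constructor <;> linarith [h (X i), h' (X i), h (Function.update X i y i),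
    h' (Function.update X i y i)]

theorem truncatedMeanSup_update_le (hr : 0 < r)
    (X : Fin k → EuclideanSpace ℝ (Fin d)) (i : Fin k) (y : EuclideanSpace ℝ (Fin d)) :
    |truncatedMeanSup N r (Function.update X i y) - truncatedMeanSup N r X| ≤ 1 / k := by
  have h := fun v : FrobeniusBall d N => abs_le.1 (truncatedMean_update_le hr v X i y)
  rw [abs_le]
  constructor
  · have : truncatedMeanSup N r X ≤ truncatedMeanSup N r (Function.update X i y) + 1 / k :=
      ciSup_le fun v => by
        have := le_ciSup (bddAbove_truncatedMean (r := r) (Function.update X i y)) v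
        have h' := (h v).1
        simp only [truncatedMeanSup]
        linarith
    linarith
  · have : truncatedMeanSup N r (Function.update X i y) ≤ truncatedMeanSup N r X + 1 / k :=
      ciSup_le fun v => by
        have := le_ciSup (bddAbove_truncatedMean (r := r) X) v
        have h' := (h v).2
        simp only [truncatedMeanSup]
        linarith
    linarith

theorem truncatedMeanSup_le (hr : 0 < r) {X : Fin k → EuclideanSpace ℝ (Fin d)} {S : ℝ}
    (hS0 : 0 ≤ S) (hS : ∀ u, ∑ i, |inner ℝ (X i) u| ≤ S * ‖u‖) :
    truncatedMeanSup N r X ≤ 9 / 5 * S / (k * r) := by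
  refine ciSup_le fun v => ?_
  calc truncatedMean r v X ≤ 1 / k * ∑ i, ‖∑ j, X i j • v.1 j‖ / r := by
        unfold truncatedMean
        gcongr
        exact min_le_right _ _
    _ = (∑ i, ‖∑ j, X i j • v.1 j‖) / (k * r) := by
        rw [← Finset.sum_div, one_div, div_mul_eq_div_div_swap, div_eq_inv_mul _ (k : ℝ)]
    _ ≤ _ := by
        gcongr
        exact sum_norm_sum_smul_le hS0 hS v.2

theorem sum_abs_inner_le_deviationSup {m : EuclideanSpace ℝ (Fin d) → ℝ} {M : ℝ}
    (hm : ∀ u, 0 ≤ m u) (hM : ∀ u, ‖u‖ ≤ 1 → m u ≤ M) (X : Fin k → EuclideanSpace ℝ (Fin d))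
    (u : EuclideanSpace ℝ (Fin d)) :
    ∑ i, |inner ℝ (X i) u| ≤ (deviationSup m 0 X + k * M) * ‖u‖ := by
  rcases eq_or_ne u 0 with rfl | hu
  · simp
  have hu' : 0 < ‖u‖ := norm_pos_iff.2 hu
  set e := ‖u‖⁻¹ • u with he
  have he1 : ‖e‖ = 1 := norm_smul_inv_norm hu
  have h := le_ciSup (bddAbove_deviation hm 0 X) ⟨e, mem_closedBall_zero_iff.2 he1.le⟩
  change _ ≤ deviationSup m 0 X at h
  simp only [inner_zero_left, zero_add, Finset.sum_sub_distrib, Finset.sum_const, Finset.card_univ,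
    Fintype.card_fin, nsmul_eq_mul] at h
  have h1 := mul_le_mul_of_nonneg_left (hM e he1.le) (Nat.cast_nonneg (α := ℝ) k)
  have h2 : ∑ i, |inner ℝ (X i) u| = (∑ i, |inner ℝ (X i) e|) * ‖u‖ := by
    rw [Finset.sum_mul]
    refine Finset.sum_congr rfl fun i _ => ?_
    rw [he, real_inner_smul_right, abs_mul, abs_of_pos (inv_pos.2 hu')]
    field_simp
  rw [h2]
  gcongr
  linarith

end GramRelaxation

/-! ### From the SDP to Gram vectors. -/

open scoped MatrixOrder Matrix.Norms.L2Operator in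
theorem exists_eq_conjTranspose_mul_self {ι : Type*} [Fintype ι] {A : Matrix ι ι ℝ}
    (hA : A.PosSemidef) : ∃ B : Matrix ι ι ℝ, A = B.conjTranspose * B := by
  classical
  exact CStarAlgebra.nonneg_iff_eq_star_mul_self.mp hA.nonneg

namespace CentralitySDP

variable {k d : ℕ}

/-- The columns of a factor L with Y = LᵀL are Gram vectors for Y. The diagonal and trace
constraints become norm bounds, and both bounds on b_i are Cauchy-Schwarz. -/
theorem value_le_truncatedMeanSup {Z : Fin k → EuclideanSpace ℝ (Fin d)}
    {x : EuclideanSpace ℝ (Fin d)} {r : ℝ} (hr : 0 < r) :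
    value Z x r ≤ truncatedMeanSup (Fintype.card (SDPIndex k d)) r fun i => Z i - x := by
  refine csSup_le (objective_nonempty Z x r) ?_
  rintro _ ⟨Y, hY, rfl⟩
  obtain ⟨L, hL⟩ := exists_eq_conjTranspose_mul_self hY.posSemidef
  set e := (Fintype.equivFin (SDPIndex k d)).symm
  set y : SDPIndex k d → EuclideanSpace ℝ (Fin (Fintype.card (SDPIndex k d))) :=
    fun a => WithLp.toLp 2 fun p => L (e p) a with hy
  have hin : ∀ a b, inner ℝ (y a) (y b) = Y a b := fun a b => by
    rw [hL, Matrix.mul_apply, ← e.sum_comp]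
    simp only [hy, PiLp.inner_apply, RCLike.inner_apply, conj_trivial, Matrix.conjTranspose_apply,
      star_trivial]
    exact Finset.sum_congr rfl fun p _ => mul_comm _ _
  have hsq : ∀ a, ‖y a‖ ^ 2 = Y a a := fun a => by rw [← real_inner_self_eq_norm_sq, hin]
  have h0 : ‖y (.inl ())‖ ≤ 1 := by
    rw [← sq_le_one_iff₀ (norm_nonneg _), hsq, hY.corner]
  have hi : ∀ i : Fin k, ‖y (.inr (.inl i))‖ ≤ 1 := fun i => by
    rw [← sq_le_one_iff₀ (norm_nonneg _), hsq]
    exact hY.diag_le i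
  let v : FrobeniusBall d (Fintype.card (SDPIndex k d)) := ⟨fun j => y (.inr (.inr j)), by
    simp only [hsq]
    exact hY.trace_le⟩
  refine le_trans ?_ (le_ciSup (bddAbove_truncatedMean _) v)
  unfold objective truncatedMean
  gcongr with i
  refine le_min ?_ ?_
  · rw [blockb, ← hin]
    exact (real_inner_le_norm _ _).trans (mul_le_one₀ (hi i) (norm_nonneg _) h0)
  · rw [le_div_iff₀ hr, mul_comm]
    refine (hY.inner_ge i).trans ?_
    have e1 : inner ℝ (Z i - x) (rowW Y i)
        = inner ℝ (y (.inr (.inl i))) (∑ j, (Z i - x) j • v.1 j) := by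
      rw [inner_sum, PiLp.inner_apply]
      refine Finset.sum_congr rfl fun j _ => ?_
      rw [real_inner_smul_right, hin]
      simp [rowW, mul_comm]
    rw [e1]
    exact (real_inner_le_norm _ _).trans (mul_le_of_le_one_left (norm_nonneg _) (hi i))

end CentralitySDP

/-! ### Trace and operator norm of the covariance as second moments. -/

section Covariance

variable {d : ℕ} {Ω : Type*} [MeasurableSpace Ω] {P : Measure Ω} [IsProbabilityMeasure P]
  {Z : Ω → EuclideanSpace ℝ (Fin d)}

theorem memLp_sub_mean (hZ : MemLp Z 2 P) : MemLp (fun ω => Z ω - ∫ ω', Z ω' ∂P) 2 P :=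
  hZ.sub (memLp_const _)

theorem integral_euclideanSpace_apply (hZ : MemLp Z 2 P) (a : Fin d) :
    (∫ ω, Z ω ∂P) a = ∫ ω, Z ω a ∂P :=
  ((EuclideanSpace.proj (𝕜 := ℝ) a).integral_comp_comm (hZ.integrable one_le_two)).symm

theorem covMatrix_apply (hZ : MemLp Z 2 P) (a b : Fin d) :
    covMatrix Z P a b
      = ∫ ω, (Z ω - ∫ ω', Z ω' ∂P) a * (Z ω - ∫ ω', Z ω' ∂P) b ∂P := by
  simp only [covMatrix, Matrix.of_apply, covariance, PiLp.sub_apply,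
    integral_euclideanSpace_apply hZ]

theorem integrable_sub_mean_mul (hZ : MemLp Z 2 P) (a b : Fin d) :
    Integrable (fun ω => (Z ω - ∫ ω', Z ω' ∂P) a * (Z ω - ∫ ω', Z ω' ∂P) b) P := by
  have h : ∀ a : Fin d, MemLp (fun ω => (Z ω - ∫ ω', Z ω' ∂P) a) 2 P := fun a =>
    (EuclideanSpace.proj (𝕜 := ℝ) a).comp_memLp' (memLp_sub_mean hZ)
  exact (h a).integrable_mul (h b)

theorem integral_norm_sub_mean_sq (hZ : MemLp Z 2 P) :
    ∫ ω, ‖Z ω - ∫ ω', Z ω' ∂P‖ ^ 2 ∂P = (covMatrix Z P).trace := by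
  simp only [Matrix.trace, Matrix.diag_apply, covMatrix_apply hZ]
  rw [← integral_finsetSum _ fun a _ => integrable_sub_mean_mul hZ a a]
  simp only [EuclideanSpace.real_norm_sq_eq]
  simp only [sq]

theorem integral_inner_sub_mean_sq_le (hZ : MemLp Z 2 P) {u : EuclideanSpace ℝ (Fin d)}
    (hu : ‖u‖ ≤ 1) :
    ∫ ω, (inner ℝ (Z ω - ∫ ω', Z ω' ∂P) u) ^ 2 ∂P ≤ matrixOpNorm (covMatrix Z P) := by
  set T := Matrix.toEuclideanCLM (n := Fin d) (𝕜 := ℝ) (covMatrix Z P) with hT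
  have h1 : ∫ ω, (inner ℝ (Z ω - ∫ ω', Z ω' ∂P) u) ^ 2 ∂P = inner ℝ u (T u) := by
    have e : ∀ ω, (inner ℝ (Z ω - ∫ ω', Z ω' ∂P) u) ^ 2 = ∑ a, ∑ b, u a * u b *
        ((Z ω - ∫ ω', Z ω' ∂P) a * (Z ω - ∫ ω', Z ω' ∂P) b) := fun ω => by
      rw [PiLp.inner_apply, sq, Finset.sum_mul_sum]
      refine Finset.sum_congr rfl fun a _ => Finset.sum_congr rfl fun b _ => ?_
      simp only [RCLike.inner_apply, conj_trivial]
      ring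
    simp_rw [e]
    rw [integral_finsetSum _ fun a _ => integrable_finsetSum _ fun b _ =>
      (integrable_sub_mean_mul hZ a b).const_mul _, PiLp.inner_apply]
    refine Finset.sum_congr rfl fun a _ => ?_
    rw [integral_finsetSum _ fun b _ => (integrable_sub_mean_mul hZ a b).const_mul _]
    simp only [integral_const_mul, ← covMatrix_apply hZ, RCLike.inner_apply, conj_trivial, hT,
      Matrix.ofLp_toEuclideanCLM, Matrix.mulVec, dotProduct, Finset.sum_mul]
    refine Finset.sum_congr rfl fun b _ => ?_
    ring
  rw [h1]
  calc inner ℝ u (T u) ≤ ‖u‖ * ‖T u‖ := real_inner_le_norm _ _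
    _ ≤ 1 * (‖T‖ * 1) := by
        gcongr
        exact (T.le_opNorm u).trans (by gcongr)
    _ = _ := by rw [one_mul, mul_one]; rfl

end Covariance

/-! ### Expectation and tail of the relaxed value. -/

section Concentration

variable {k d : ℕ} {ν : Measure (EuclideanSpace ℝ (Fin d))} [IsProbabilityMeasure ν]

theorem integral_truncatedMeanSup_le (hk : 0 < k) {r : ℝ} (hr : 0 < r) {N : ℕ}
    (hint : Integrable (fun x => x) ν) (hint2 : Integrable (fun x => ‖x‖ ^ 2) ν) {M : ℝ}
    (hM : ∀ u, ‖u‖ ≤ 1 → ∫ y, |inner ℝ y u| ∂ν ≤ M) :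
    ∫ X : Fin k → EuclideanSpace ℝ (Fin d), truncatedMeanSup N r X ∂(Measure.pi fun _ => ν)
      ≤ 9 / 5 * (2 * √((∫ x, ‖x‖ ^ 2 ∂ν) / k) + M) / r := by
  have hk' : (0 : ℝ) < k := by exact_mod_cast hk
  set τ := ∫ x, ‖x‖ ^ 2 ∂ν with hτ
  have hτ0 : 0 ≤ τ := integral_nonneg fun _ => by positivity
  set m : EuclideanSpace ℝ (Fin d) → ℝ := fun u => ∫ y, |inner ℝ y u| ∂ν with hmdef
  have hm : ∀ u, 0 ≤ m u := fun u => integral_nonneg fun _ => abs_nonneg _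
  have hm0 : m 0 = 0 := by simp [hmdef]
  have hM0 : 0 ≤ M := (hm 0).trans (hM 0 (by simp))
  have hdev := integral_deviationSup_le hint hint2 k 0
  have hmeas : Measurable fun X : Fin k → EuclideanSpace ℝ (Fin d) => deviationSup m 0 X :=
    measurable_deviationSup_right hm 0
  have hI : Integrable (fun X : Fin k → EuclideanSpace ℝ (Fin d) => deviationSup m 0 X)
      (Measure.pi fun _ => ν) := by
    have hs := integrable_sum_norm_pi hint k
    have hle : ∀ X : Fin k → EuclideanSpace ℝ (Fin d), ‖deviationSup m 0 X‖ ≤ ∑ i, ‖X i‖ := by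
      intro X
      rw [Real.norm_eq_abs, abs_of_nonneg (deviationSup_nonneg hm hm0 _ _)]
      simpa using deviationSup_le hm 0 X
    exact hs.mono' hmeas.aestronglyMeasurable (.of_forall hle)
  have hpt : ∀ X : Fin k → EuclideanSpace ℝ (Fin d), truncatedMeanSup N r X
      ≤ 9 / 5 * (deviationSup m 0 X + k * M) / (k * r) := fun X =>
    truncatedMeanSup_le hr (add_nonneg (deviationSup_nonneg hm hm0 _ _) (by positivity))
      (sum_abs_inner_le_deviationSup hm hM X)
  have hIG : Integrable (fun X : Fin k → EuclideanSpace ℝ (Fin d) => truncatedMeanSup N r X)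
      (Measure.pi fun _ => ν) :=
    .of_bound measurable_truncatedMeanSup.aestronglyMeasurable 1
      (.of_forall fun X => abs_truncatedMeanSup_le_one hr X)
  have hIS : Integrable (fun X : Fin k → EuclideanSpace ℝ (Fin d) =>
      9 / 5 * (deviationSup m 0 X + k * M) / (k * r)) (Measure.pi fun _ => ν) :=
    ((hI.add (integrable_const _)).const_mul _).div_const _
  have hsqrt : √(‖(0 : EuclideanSpace ℝ (Fin d))‖ ^ 2 + 4 * k * τ) = 2 * k * √(τ / k) := by
    rw [show ‖(0 : EuclideanSpace ℝ (Fin d))‖ ^ 2 + 4 * k * τ = (2 * k) ^ 2 * (τ / k) by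
      rw [norm_zero]; field_simp; ring, Real.sqrt_mul (by positivity),
      Real.sqrt_sq (by positivity)]
  rw [hsqrt] at hdev
  calc _ ≤ ∫ X : Fin k → EuclideanSpace ℝ (Fin d),
        9 / 5 * (deviationSup m 0 X + k * M) / (k * r) ∂(Measure.pi fun _ => ν) :=
        integral_mono hIG hIS hpt
    _ = 9 / 5 * ((∫ X : Fin k → EuclideanSpace ℝ (Fin d), deviationSup m 0 X
          ∂(Measure.pi fun _ => ν)) + k * M) / (k * r) := by
        rw [integral_div, integral_const_mul, integral_add hI (integrable_const _)]
        simp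
    _ ≤ 9 / 5 * (2 * k * √(τ / k) + k * M) / (k * r) := by
        gcongr
    _ = _ := by field_simp

theorem measureReal_truncatedMeanSup_gt_le (hk : 0 < k) {r : ℝ} (hr : 0 < r) {N : ℕ}
    (hE : ∫ X : Fin k → EuclideanSpace ℝ (Fin d), truncatedMeanSup N r X ∂(Measure.pi fun _ => ν)
      ≤ 1 / 200) :
    (Measure.pi fun _ => ν).real {X : Fin k → EuclideanSpace ℝ (Fin d) |
      1 / 100 < truncatedMeanSup N r X} ≤ 2 ^ (-(1 / 80000 * (k : ℝ))) := by
  have hk' : (0 : ℝ) < k := by exact_mod_cast hk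
  have h := measureReal_ge_le_of_boundedDifferences (ν := ν) (c := 1 / k) (M := 1) (ε := 1 / 200)
    (by positivity) (by norm_num) hk (measurable_truncatedMeanSup (N := N) (r := r))
    (abs_truncatedMeanSup_le_one hr) (truncatedMeanSup_update_le hr)
  refine (measureReal_mono fun X hX => ?_).trans (h.trans ?_)
  · have : 1 / 100 < truncatedMeanSup N r X := hX
    change _ ≤ truncatedMeanSup N r X
    linarith
  -- McDiarmid with c = 1/k and ε = 1/200 gives exp(-k/80000); base e may be replaced by 2 since log
  -- 2 < 1.
  · rw [Real.rpow_def_of_pos two_pos, Real.exp_le_exp]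
    have e : -(1 / 200 : ℝ) ^ 2 / (2 * k * (1 / k) ^ 2) = -(1 / 80000 * k) := by
      field_simp
      norm_num
    rw [e]
    have := Real.log_two_lt_d9
    nlinarith

end Concentration

theorem mainTheorem2 :
    ∃ C > (0 : ℝ), ∃ c > (0 : ℝ), ∀ (d k : ℕ), 1 ≤ k →
      ∀ (Ω₀ : Type*) [MeasurableSpace Ω₀] (P₀ : Measure Ω₀) [IsProbabilityMeasure P₀]
        (Z : Ω₀ → EuclideanSpace ℝ (Fin d)), MemLp Z 2 P₀ →
      ∀ (Ω : Type*) [MeasurableSpace Ω] (P : Measure Ω) [IsProbabilityMeasure P]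
        (Zs : Fin k → Ω → EuclideanSpace ℝ (Fin d)),
        iIndepFun Zs P → (∀ i, IdentDistrib (Zs i) Z P P₀) →
      ∀ r : ℝ, 0 < r →
        C * (Real.sqrt ((covMatrix Z P₀).trace / k) + Real.sqrt (matrixOpNorm (covMatrix Z P₀)))
          ≤ r →
        P {ω | ¬ CertifiablyCentral (fun i => Zs i ω) r (1 / 100) (∫ ω₀, Z ω₀ ∂P₀)}
          ≤ ENNReal.ofReal ((2 : ℝ) ^ (-(c * (k : ℝ)))) := by
  -- 720 = 200 · (9/5) · 2 makes the expectation at most 1/200, half the allowed 1/100; the other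
  -- half is the deviation ε.
  refine ⟨720, by norm_num, 1 / 80000, by norm_num, ?_⟩
  intro d k hk Ω₀ _ P₀ _ Z hZ Ω _ P _ Zs hind hid r hr hrC
  set μ := ∫ ω₀, Z ω₀ ∂P₀ with hμ
  set X : Ω₀ → EuclideanSpace ℝ (Fin d) := fun ω => Z ω - μ with hXdef
  have hX2 : MemLp X 2 P₀ := memLp_sub_mean hZ
  have hXm : AEMeasurable X P₀ := hX2.aestronglyMeasurable.aemeasurable
  set ν := P₀.map X with hν
  have : IsProbabilityMeasure ν := Measure.isProbabilityMeasure_map hXm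
  have hint : Integrable (fun x => x) ν :=
    (integrable_map_measure aestronglyMeasurable_id hXm).2 (hX2.integrable one_le_two)
  have hint2 : Integrable (fun x => ‖x‖ ^ 2) ν :=
    (integrable_map_measure (by fun_prop) hXm).2 hX2.integrable_norm_pow'
  have htr : ∫ x, ‖x‖ ^ 2 ∂ν = (covMatrix Z P₀).trace := by
    rw [hν, integral_map hXm (by fun_prop), ← integral_norm_sub_mean_sq hZ]
  have hM : ∀ u, ‖u‖ ≤ 1 → ∫ y, |inner ℝ y u| ∂ν ≤ √(matrixOpNorm (covMatrix Z P₀)) :=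
    fun u hu => by
    have hsq : Integrable (fun y => (inner ℝ y u) ^ 2) ν := by
      refine hint2.mono' (by fun_prop) (.of_forall fun y => ?_)
      rw [Real.norm_eq_abs, abs_of_nonneg (sq_nonneg _), ← sq_abs]
      gcongr
      exact abs_inner_closedBall_le y ⟨u, mem_closedBall_zero_iff.2 hu⟩
    have h := integral_sqrt_le_sqrt_integral (fun y => sq_nonneg (inner ℝ y u)) hsq
    simp only [Real.sqrt_sq_eq_abs] at h
    refine h.trans (Real.sqrt_le_sqrt ?_)
    rw [hν, integral_map hXm (by fun_prop)]
    exact integral_inner_sub_mean_sq_le hZ hu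
  set N := Fintype.card (SDPIndex k d)
  have hE : ∫ X : Fin k → EuclideanSpace ℝ (Fin d), truncatedMeanSup N r X
      ∂(Measure.pi fun _ => ν) ≤ 1 / 200 := by
    refine (integral_truncatedMeanSup_le hk hr hint hint2 hM).trans ?_
    rw [htr, div_le_iff₀ hr]
    have := Real.sqrt_nonneg (matrixOpNorm (covMatrix Z P₀))
    linarith
  have hY : ∀ i, AEMeasurable (fun ω => Zs i ω - μ) P := fun i =>
    (hid i).aemeasurable_fst.sub_const μ
  have hlaw : P.map (fun ω i => Zs i ω - μ) = Measure.pi fun _ => ν := by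
    have hind' : iIndepFun (fun i ω => Zs i ω - μ) P :=
      hind.comp (fun _ x => x - μ) fun _ => measurable_sub_const μ
    rw [(iIndepFun_iff_map_fun_eq_pi_map hY).1 hind']
    congr 1
    ext1 i
    exact ((hid i).comp (measurable_sub_const μ)).map_eq
  have hset : MeasurableSet {X : Fin k → EuclideanSpace ℝ (Fin d) |
      1 / 100 < truncatedMeanSup N r X} :=
    measurableSet_lt measurable_const measurable_truncatedMeanSup
  -- Measurability of the failure event is not needed: it is enclosed in the preimage of a
  -- measurable set.
  calc P {ω | ¬ CertifiablyCentral (fun i => Zs i ω) r (1 / 100) μ}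
      ≤ P ((fun ω i => Zs i ω - μ) ⁻¹' {X | 1 / 100 < truncatedMeanSup N r X}) := by
        refine measure_mono fun ω hω => ?_
        exact (not_le.1 hω).trans_le (CentralitySDP.value_le_truncatedMeanSup hr)
    _ = (Measure.pi fun _ => ν) {X : Fin k → EuclideanSpace ℝ (Fin d) |
          1 / 100 < truncatedMeanSup N r X} := by
        rw [← hlaw, Measure.map_apply_of_aemeasurable (aemeasurable_pi_lambda _ hY) hset]
    _ ≤ _ := by
        rw [← ofReal_measureReal]
        exact ENNReal.ofReal_le_ofReal (measureReal_truncatedMeanSup_gt_le hk hr hE)
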